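/- Let $\mathfrak g$ be a finite-dimensional complex semisimple Lie algebra with Killing form $\langle\cdot|\cdot\rangle$ and adjoint group $G$ (generated by all $\exp(\operatorname{ad} y)$, $y\in\mathfrak g$). Orthogonals $\perp$ are taken with respect to $\langle\cdot|\cdot\rangle$; $\mathfrak g(y)$ denotes the centralizer of $y$ in $\mathfrak g$, and $G(s)=\{g\in G: g\cdot s=s\}$. Identifying $\mathfrak g\cong\mathfrak g^*$ by the Killing form, $\mathfrak g$ carries the Lie–Poisson structure $\{F,H\}(y)=\langle y|[dF(y),dH(y)]\rangle$; similarly for $\mathfrak g(s)$ with the restriction of $\langle\cdot|\cdot\rangle$, when that restriction is non-degenerate. An affine subspace $N$ of a vector space $M$ with $m\in N$ is a transverse slice at $m$ to an orbit $S\subset M$ through $m$ if $T_mM=T_mS\oplus T_mN$; the transverse Poisson structure on $N$ near $m$ is the one induced by Dirac reduction: at $y\in N$, extend covectors on $T_yN$ to covectors on $T_yM$ whose Hamiltonian vectors are tangent to $N$ and apply the Poisson tensor of $M$ (this is defined at $y$ when the Poisson tensor is non-degenerate on the covectors vanishing on $T_yN$). Let $x\in\mathfrak g$ with Jordan–Chevalley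 decomposition $x=s+e$ ($\operatorname{ad}s$ semisimple, $\operatorname{ad}e$ nilpotent, $[s,e]=0$). Put $\mathfrak n_s=\mathfrak g(s)^\perp$, let $\mathfrak n_e$ be any complement of $\mathfrak g(x)$ in $\mathfrak g(s)$, and let $\mathfrak n=\mathfrak n_s+\mathfrak n_e$, $N_x=x+\mathfrak n^\perp$, $N=e+\mathfrak n^\perp$. Let $(Z_i)$ be a basis of $\mathfrak g(x)$ and $(X_m)$ a basis of $\mathfrak n_e$. Then: 1. The sum $\mathfrak n=\mathfrak n_s\oplus\mathfrak n_e$ is direct, and the restriction of $\langle\cdot|\cdot\rangle$ to $\mathfrak g(s)$ is non-degenerate. 2. $N_x$ is a transverse slice at $x$ to $G\cdot x$ in $\mathfrak g$; and $N\subset\mathfrak g(s)$ is a transverse slice at $e$ to the nilpotent orbit $G(s)\cdot e$ in $\mathfrak g(s)$. 3. The functions $q_i(y)=\langle y-x|Z_i\rangle$ on $N_x$, respectively $q_i(y)=\langle y-e|Z_i\rangle$ on $N$ (which correspond under the translation $N_x=s+N$), form a system of affine coordinates. The transverse Poisson structure of $N_x$ (induced from $\mathfrak g$), respectively of $N$ (induced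 from $\mathfrak g(s)$), is defined in a neighbourhood of $x$ in $N_x$, respectively of $e$ in $N$. At every point $y$ of $N_x$ (respectively of $N$) where it is defined, $C_e(y)$ is invertible and the Poisson matrix $(\{q_i,q_j\}(y))_{i,j}$ equals $$\Lambda(y)=A(y)+B_e(y)\,C_e(y)^{-1}\,B_e(y)^{T},$$ where $A_{ij}(y)=\langle y|[Z_i,Z_j]\rangle$, $(B_e)_{im}(y)=\langle y|[Z_i,X_m]\rangle$, $(C_e)_{lm}(y)=\langle y|[X_l,X_m]\rangle$. 4. Both slices carry the same Poisson matrix in the same coordinates: if $y\in N_x$ and $y'\in N$ have the same coordinates, then $\Lambda(y)=\Lambda(y')$; and if the structure on $N_x$ is defined at $y$, then that on $N$ is defined at $y'$ and the two Poisson matrices at $y$ and $y'$ are equal. -/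

import Mathlib

open Module Topology

noncomputable section

namespace TransversePoisson

/-! ### Centralizers and the adjoint group -/

section Group

variable {L : Type*} [LieRing L] [LieAlgebra ℂ L]

/-- The centralizer `𝔤(x) = {y | [x, y] = 0}` of an element `x`, as a Lie subalgebra. -/
def centralizer (x : L) : LieSubalgebra ℂ L where
  carrier := {y | ⁅x, y⁆ = 0}
  add_mem' {a b} ha hb := by
    change ⁅x, a⁆ = 0 at ha
    change ⁅x, b⁆ = 0 at hb
    change ⁅x, a + b⁆ = 0
    rw [lie_add, ha, hb, add_zero]
  zero_mem' := lie_zero x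
  smul_mem' c a ha := by
    change ⁅x, a⁆ = 0 at ha
    change ⁅x, c • a⁆ = 0
    rw [lie_smul, ha, smul_zero]
  lie_mem' {a b} ha hb := by
    change ⁅x, a⁆ = 0 at ha
    change ⁅x, b⁆ = 0 at hb
    change ⁅x, ⁅a, b⁆⁆ = 0
    rw [leibniz_lie, ha, hb, zero_lie, lie_zero, add_zero]

variable [FiniteDimensional ℂ L]

/-- The exponential `∑ fⁿ / n!` of an endomorphism of a finite-dimensional complex vector space,
computed on matrices with respect to some basis (the result does not depend on the basis). -/
def endExp (f : L →ₗ[ℂ] L) : L →ₗ[ℂ] L :=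
  Matrix.toLin (finBasis ℂ L) (finBasis ℂ L)
    (NormedSpace.exp (LinearMap.toMatrix (finBasis ℂ L) (finBasis ℂ L) f))

variable (L) in
/-- The adjoint group `G` of `𝔤`: the subgroup of `GL(𝔤)` generated by all `exp (ad y)`. -/
def adjointGroup : Subgroup (L ≃ₗ[ℂ] L) :=
  Subgroup.closure {g | ∃ y : L, (g : L →ₗ[ℂ] L) = endExp (LieAlgebra.ad ℂ L y)}

/-- The centralizer `G(s) = {g ∈ G | g · s = s}` of `s` in the adjoint group. -/
def groupCentralizer (s : L) : Subgroup (L ≃ₗ[ℂ] L) :=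
  adjointGroup L ⊓ MulAction.stabilizer (L ≃ₗ[ℂ] L) s

end Group

/-! ### Orbits and transverse slices -/

section Slice

variable {V : Type*} [AddCommGroup V] [Module ℂ V]

/-- The orbit `H · p` of `p` under a group `H` of linear automorphisms of `V`. -/
def orbit (H : Subgroup (V ≃ₗ[ℂ] V)) (p : V) : Set V := {y | ∃ g ∈ H, g p = y}

/-- The tangent space at `p` of the orbit `H · p`, i.e. the image of the differential at the
identity of the orbit map `H → V, g ↦ g · p`: the velocities at `t = 0` of the curves
`t ↦ g(t) · p`, for `g` a holomorphic curve in `H` that is defined near `0 ∈ ℂ`, with `g(0) = 1`.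
Holomorphy and derivatives are expressed in (arbitrary) linear coordinates `φ`, which for a
finite-dimensional `V` is the usual meaning. (These velocities already form a
subspace; the span only packages them as one.) -/
def orbitTangent (H : Subgroup (V ≃ₗ[ℂ] V)) (p : V) : Submodule ℂ V :=
  Submodule.span ℂ {v | ∃ g : ℂ → (V ≃ₗ[ℂ] V), g 0 = 1 ∧
    (∀ᶠ t in 𝓝 (0 : ℂ), g t ∈ H) ∧
    (∀ᶠ t in 𝓝 (0 : ℂ), ∀ (z : V) (φ : Dual ℂ V), DifferentiableAt ℂ (fun u => φ (g u z)) t) ∧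
    ∀ φ : Dual ℂ V, HasDerivAt (fun u => φ (g u p)) (φ v) 0}

/-- The affine subspace `N` is a transverse slice at `p` to the orbit `H · p`, inside the vector
space `M` (a subspace of `V`): the orbit and `N` lie in `M`, the point `p` lies in `N`, and
`T_p M = T_p (H · p) ⊕ T_p N`. -/
structure IsTransverseSlice (H : Subgroup (V ≃ₗ[ℂ] V)) (M : Submodule ℂ V) (p : V)
    (N : AffineSubspace ℂ V) : Prop where
  orbit_subset : orbit H p ⊆ M
  slice_subset : (N : Set V) ⊆ M
  mem : p ∈ N
  disjoint : Disjoint (orbitTangent H p) N.direction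
  sup_eq : orbitTangent H p ⊔ N.direction = M

/-- An affine subspace `N ⊆ M ⊆ V`, seen as an affine subspace of `M`. -/
def sliceIn (M : Submodule ℂ V) (N : AffineSubspace ℂ V) : AffineSubspace ℂ M :=
  N.comap M.subtype.toAffineMap

/-- The affine coordinate `y ↦ Φ(y - p, z)`, centered at `p`. -/
def affineCoord (Φ : LinearMap.BilinForm ℂ V) (p z : V) : V →ᵃ[ℂ] ℂ where
  toFun y := Φ (y - p) z
  linear := Φ.flip z
  map_vadd' y v := by
    rw [vadd_eq_add, add_sub_assoc, map_add, LinearMap.add_apply]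
    rfl

end Slice

/-! ### Poisson tensors and Dirac reduction

A Poisson structure on a vector space `V` is given through its Poisson tensor at each point `y`,
a bilinear form `P` on `T_y^* V = V^*`; the bracket is `{F, G}(y) = P (dF(y)) (dG(y))`. -/

section Dirac

variable {V : Type*} [AddCommGroup V] [Module ℂ V]

/-- The submanifold with tangent space `W` at the given point is cosymplectic there (the Poisson
tensor `P` is non-degenerate on conormal covectors, i.e. the matrix of brackets of constraints is
invertible), so that Dirac reduction is possible at that point. -/
def IsCosymplectic (P : LinearMap.BilinForm ℂ (Dual ℂ V)) (W : Submodule ℂ V) : Prop :=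
  (P.restrict W.dualAnnihilator).Nondegenerate

open Classical in
/-- The extension of a covector `α` on `W` to a covector on `V` whose Hamiltonian vector is tangent
to `W`, i.e. which is `P`-orthogonal to all conormal covectors. It exists and is unique when
`IsCosymplectic P W` holds (and is set to `0` if there is none). -/
def tangentExtension (P : LinearMap.BilinForm ℂ (Dual ℂ V)) (W : Submodule ℂ V)
    (α : Dual ℂ W) : Dual ℂ V :=
  if h : ∃ a : Dual ℂ V, a.domRestrict W = α ∧ ∀ c ∈ W.dualAnnihilator, P a c = 0 then h.choose
  else 0

/-- The Poisson tensor induced by Dirac reduction on `W`: extend the covectors so that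
their Hamiltonian vectors are tangent to `W`, and apply `P`. -/
def reducedTensor (P : LinearMap.BilinForm ℂ (Dual ℂ V)) (W : Submodule ℂ V)
    (α β : Dual ℂ W) : ℂ :=
  P (tangentExtension P W α) (tangentExtension P W β)

end Dirac

section LiePoisson

variable {V : Type*} [LieRing V] [LieAlgebra ℂ V] [FiniteDimensional ℂ V]

open Classical in
/-- The identification `V^* ≅ V` by a non-degenerate bilinear form `Φ` (junk value `0` if `Φ` is
degenerate). -/
def sharp (Φ : LinearMap.BilinForm ℂ V) : Dual ℂ V →ₗ[ℂ] V :=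
  if h : Φ.Nondegenerate then (Φ.toDual h).symm.toLinearMap else 0

/-- The Poisson tensor at `y` of the Lie-Poisson structure of a Lie algebra that is identified
with its dual by `Φ`: `(α, β) ↦ Φ(y, [α, β])`, covectors being seen as elements of `V`. -/
def liePoisson (Φ : LinearMap.BilinForm ℂ V) (y : V) : LinearMap.BilinForm ℂ (Dual ℂ V) :=
  LinearMap.mk₂ ℂ (fun α β => Φ y ⁅sharp Φ α, sharp Φ β⁆)
    (by intros; simp) (by intros; simp) (by intros; simp) (by intros; simp)

/-- The affine subspace `N` inherits at `y ∈ N` a Poisson structure from the Lie-Poisson structure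
by Dirac reduction. -/
def IsRegularAt (Φ : LinearMap.BilinForm ℂ V) (N : AffineSubspace ℂ V) (y : V) : Prop :=
  IsCosymplectic (liePoisson Φ y) N.direction

/-- The Poisson matrix `({q_i, q_j}_N (y))` at `y ∈ N` of the transverse Poisson structure on the
slice `N`, in terms of the restrictions to `N` of affine functions `q_i`. -/
def slicePoissonMatrix {ι : Type*} (Φ : LinearMap.BilinForm ℂ V) (N : AffineSubspace ℂ V)
    (q : ι → V →ᵃ[ℂ] ℂ) (y : V) : Matrix ι ι ℂ :=
  Matrix.of fun i j => reducedTensor (liePoisson Φ y) N.direction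
    ((q i).linear.domRestrict N.direction) ((q j).linear.domRestrict N.direction)

/-- The matrix `(Φ(y, [U_i, T_j]))` of Lie-Poisson brackets at `y` of two families of
(linear functions given by) elements. -/
def bracketMatrix {ι κ : Type*} (Φ : LinearMap.BilinForm ℂ V) (U : ι → V) (T : κ → V) (y : V) :
    Matrix ι κ ℂ :=
  Matrix.of fun i j => Φ y ⁅U i, T j⁆

/-- The matrix `A(y) + B(y) C(y)⁻¹ B(y)ᵀ` with `A = (Φ(y, [Z_i, Z_j]))`, `B = (Φ(y, [Z_i, X_m]))`
and `C = (Φ(y, [X_l, X_m]))`. -/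
def diracMatrix {ι κ : Type*} [Fintype κ] [DecidableEq κ] (Φ : LinearMap.BilinForm ℂ V)
    (Z : ι → V) (X : κ → V) (y : V) : Matrix ι ι ℂ :=
  bracketMatrix Φ Z Z y +
    bracketMatrix Φ Z X y * (bracketMatrix Φ X X y)⁻¹ * (bracketMatrix Φ Z X y).transpose

end LiePoisson

end TransversePoisson

end

/-!
The Killing form of a semisimple Lie algebra is non-degenerate and its derivations are inner, so
curves in the adjoint group through `1` have velocity `ad y`, and the tangent space of `G · p` is
`[𝔤, p] = 𝔤(p)^⊥` (`orbitTangent_adjointGroup`, `range_ad_eq_orthogonal`); for `G(s)` one gets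
`[𝔤(s), p]` (`orbitTangent_groupCentralizer`). Semisimplicity of `ad s` gives
`𝔤 = 𝔤(s) ⊕ 𝔤(s)^⊥`, hence `𝔤 = 𝔤(x) ⊕ 𝔫`. Taking orthogonals, `𝔤 = [𝔤, x] ⊕ 𝔫^⊥`, and
intersecting with `𝔤(s) ⊇ 𝔫^⊥` gives `𝔤(s) = [𝔤(s), e] ⊕ 𝔫^⊥`: both slices are transverse, and
pairing with a basis of `𝔤(x)` gives coordinates on `𝔫^⊥` (`orthogonalCoordEquiv`).

Under `𝔤 ≅ 𝔤^*` the conormal space of the slice is `𝔫`, so Dirac reduction at `y` is possible iff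
`ω_y(a, b) = ⟨y | [a, b]⟩` is non-degenerate on `𝔫` (`isCosymplectic_orthogonal_iff`). At `y = x` the
kernel of `ω_y` is `𝔤(x)`, a complement of `𝔫`, and non-degeneracy is an open condition. On the
slices `y ∈ 𝔤(s)`, whence `ω_y` pairs `𝔤(s)` with `𝔫_s = 𝔤(s)^⊥` to zero
(`killingForm_lie_eq_zero`). Thus the constraints from `𝔫_s` decouple from those from `𝔫_e` and
from the coordinates, and the Dirac bracket only involves `C_e`
(`slicePoissonMatrix_eq_diracMatrix`); for the Lie-Poisson structure of `𝔤(s)` the conormal space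
is `𝔫_e` itself, with the same result. Finally `ω_s` vanishes on `𝔤(s)`, so that translation by `s`
changes none of the matrices.
-/

namespace TransversePoisson

/-! ### Derivatives of curves in a finite-dimensional space without a norm -/

section WeakDeriv

variable {V W U : Type*} [AddCommGroup V] [Module ℂ V] [AddCommGroup W] [Module ℂ W]
  [AddCommGroup U] [Module ℂ U]

/-- The curve `c` in a complex vector space has derivative `v` at `t`, tested on all linear
functionals. For a finite-dimensional space this is the usual notion; it needs no choice of a norm,
which a Lie algebra does not come with. -/
def HasWeakDerivAt (c : ℂ → V) (v : V) (t : ℂ) : Prop :=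
  ∀ φ : Dual ℂ V, HasDerivAt (fun u => φ (c u)) (φ v) t

namespace HasWeakDerivAt

variable {c : ℂ → V} {d : ℂ → W} {v v' : V} {w : W} {t : ℂ}

lemma const (v : V) (t : ℂ) : HasWeakDerivAt (fun _ => v) 0 t := fun φ => by
  simpa using hasDerivAt_const t (φ v)

lemma map (hc : HasWeakDerivAt c v t) (T : V →ₗ[ℂ] W) :
    HasWeakDerivAt (fun u => T (c u)) (T v) t :=
  fun φ => hc (φ ∘ₗ T)

lemma unique (h : HasWeakDerivAt c v t) (h' : HasWeakDerivAt c v' t) : v = v' := by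
  rw [← sub_eq_zero, ← Module.forall_dual_apply_eq_zero_iff ℂ]
  intro φ
  rw [map_sub, (h φ).unique (h' φ), sub_self]

lemma congr_of_eventuallyEq {c' : ℂ → V} (h : HasWeakDerivAt c v t) (hcc : c' =ᶠ[𝓝 t] c) :
    HasWeakDerivAt c' v t :=
  fun φ => (h φ).congr_of_eventuallyEq (hcc.fun_comp φ)

lemma bilin [FiniteDimensional ℂ V] [FiniteDimensional ℂ W]
    (hc : HasWeakDerivAt c v t) (hd : HasWeakDerivAt d w t) (B : V →ₗ[ℂ] W →ₗ[ℂ] U) :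
    HasWeakDerivAt (fun u => B (c u) (d u)) (B v (d t) + B (c t) w) t := by
  intro φ
  let b := finBasis ℂ V
  let b' := finBasis ℂ W
  have key (x : V) (y : W) :
      φ (B x y) = ∑ i, ∑ j, b.coord i x * b'.coord j y * φ (B (b i) (b' j)) := by
    conv_lhs => rw [← b.sum_repr x, ← b'.sum_repr y]
    simp only [map_sum, LinearMap.sum_apply, map_smul, LinearMap.smul_apply, smul_eq_mul,
      Basis.coord_apply, Finset.mul_sum]
    rw [Finset.sum_comm]
    exact Finset.sum_congr rfl fun i _ => Finset.sum_congr rfl fun j _ => by ring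
  rw [map_add, funext fun u => key (c u) (d u), key v, key (c t)]
  rw [← Finset.sum_add_distrib]
  refine HasDerivAt.fun_sum fun i _ => ?_
  rw [← Finset.sum_add_distrib]
  refine HasDerivAt.fun_sum fun j _ => ?_
  rw [← add_mul]
  exact ((hc (b.coord i)).mul (hd (b'.coord j))).mul_const _

lemma eq_of_forall_zero (h : ∀ t, HasWeakDerivAt c 0 t) (a b : ℂ) : c a = c b := by
  rw [← sub_eq_zero, ← Module.forall_dual_apply_eq_zero_iff ℂ]
  intro φ
  rw [map_sub, sub_eq_zero]
  exact is_const_of_deriv_eq_zero (fun t => (h t φ).differentiableAt)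
    (fun t => by simpa using (h t φ).deriv) a b

end HasWeakDerivAt

lemma exists_hasWeakDerivAt [FiniteDimensional ℂ V] {c : ℂ → V} {t : ℂ}
    (h : ∀ φ : Dual ℂ V, DifferentiableAt ℂ (fun u => φ (c u)) t) :
    ∃ v, HasWeakDerivAt c v t := by
  let b := finBasis ℂ V
  refine ⟨∑ i, deriv (fun u => b.coord i (c u)) t • b i, fun φ => ?_⟩
  have key (x : V) : φ x = ∑ i, b.coord i x * φ (b i) := by
    conv_lhs => rw [← b.sum_repr x]
    simp only [map_sum, map_smul, smul_eq_mul, Basis.coord_apply]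
  rw [funext fun u => key (c u)]
  simp only [map_sum, map_smul, smul_eq_mul]
  exact HasDerivAt.fun_sum fun i _ => (h (b.coord i)).hasDerivAt.mul_const _

end WeakDeriv

/-! ### The exponential of an endomorphism -/

section Exp

variable {L : Type*} [LieRing L] [LieAlgebra ℂ L] [FiniteDimensional ℂ L]

lemma endExp_zero : endExp (0 : L →ₗ[ℂ] L) = LinearMap.id := by
  simp [endExp, Matrix.toLin_one]

section
attribute [local instance] Matrix.linftyOpNormedRing Matrix.linftyOpNormedAlgebra

lemma hasWeakDerivAt_endExp (f : L →ₗ[ℂ] L) (t : ℂ) :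
    HasWeakDerivAt (fun u => endExp (u • f)) (f ∘ₗ endExp (t • f)) t := by
  intro φ
  let b := finBasis ℂ L
  let ψ : Matrix _ _ ℂ →ₗ[ℂ] ℂ := φ ∘ₗ (Matrix.toLin b b).toLinearMap
  have h := (LinearMap.toContinuousLinearMap ψ).hasFDerivAt.comp_hasDerivAt t
    (hasDerivAt_exp_smul_const' (𝕂 := ℂ) (LinearMap.toMatrix b b f) t)
  refine (h.congr_of_eventuallyEq (Filter.Eventually.of_forall fun u => ?_)).congr_deriv ?_
  · simp only [endExp, map_smul]
    rfl
  · change φ (Matrix.toLin b b _) = _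
    rw [Matrix.toLin_mul b b b, Matrix.toLin_toMatrix, ← map_smul]
    rfl

lemma endExp_neg_comp (f : L →ₗ[ℂ] L) : endExp (-f) ∘ₗ endExp f = LinearMap.id := by
  rw [endExp, endExp, ← Matrix.toLin_mul, map_neg, ← Matrix.exp_add_of_commute _ _ (by simp)]
  simp [Matrix.toLin_one]

lemma endExp_comp_self (f : L →ₗ[ℂ] L) : endExp f ∘ₗ f = f ∘ₗ endExp f := by
  let b := finBasis ℂ L
  have h : Commute (LinearMap.toMatrix b b f) (NormedSpace.exp (LinearMap.toMatrix b b f)) :=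
    (Commute.refl _).exp_right
  apply (LinearMap.toMatrix b b).injective
  rw [LinearMap.toMatrix_comp b b b, LinearMap.toMatrix_comp b b b]
  rw [endExp, LinearMap.toMatrix_toLin]
  exact h.symm.eq

end

lemma endExp_comp_neg (f : L →ₗ[ℂ] L) : endExp f ∘ₗ endExp (-f) = LinearMap.id := by
  simpa using endExp_neg_comp (-f)

/-- The exponential of an endomorphism as a linear automorphism. -/
noncomputable def expEquiv (f : L →ₗ[ℂ] L) : L ≃ₗ[ℂ] L :=
  LinearEquiv.ofLinearMap (endExp f) (endExp (-f)) (endExp_comp_neg f) (endExp_neg_comp f)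

lemma hasWeakDerivAt_endExp_apply (f : L →ₗ[ℂ] L) (z : L) (t : ℂ) :
    HasWeakDerivAt (fun u => endExp (u • f) z) (f (endExp (t • f) z)) t :=
  (hasWeakDerivAt_endExp f t).map (LinearMap.applyₗ z)

lemma endExp_apply_of_apply_eq_zero {f : L →ₗ[ℂ] L} {z : L} (hz : f z = 0) : endExp f z = z := by
  have h (t : ℂ) : HasWeakDerivAt (fun u => endExp (u • f) z) 0 t := by
    have := hasWeakDerivAt_endExp_apply f z t
    have hc := LinearMap.congr_fun (endExp_comp_self (t • f)) z
    have h0 : f (endExp (t • f) z) = 0 := by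
      rcases eq_or_ne t 0 with rfl | ht
      · simpa [endExp_zero] using hz
      · simpa [hz, ht] using hc.symm
    rwa [h0] at this
  simpa [endExp_zero] using HasWeakDerivAt.eq_of_forall_zero h 1 0

/-- The exponential of a derivation is an automorphism: the curve
`t ↦ exp(-tD) [exp(tD) a, exp(tD) b]` has vanishing derivative. -/
lemma endExp_lie {D : L →ₗ[ℂ] L} (hD : ∀ a b, D ⁅a, b⁆ = ⁅D a, b⁆ + ⁅a, D b⁆) (a b : L) :
    endExp D ⁅a, b⁆ = ⁅endExp D a, endExp D b⁆ := by
  -- `exp(tD)` commutes with `tD`, hence with `D` unless `t = 0`, where it is the identity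
  have hcomm (t : ℂ) (z : L) : endExp (t • -D) (D z) = D (endExp (t • -D) z) := by
    have hc := LinearMap.congr_fun (endExp_comp_self (t • -D)) z
    rcases eq_or_ne t 0 with rfl | ht
    · simp [endExp_zero]
    · simpa [ht] using hc
  have h (t : ℂ) : HasWeakDerivAt
      (fun u => endExp (u • -D) ⁅endExp (u • D) a, endExp (u • D) b⁆) 0 t := by
    have h1 := (hasWeakDerivAt_endExp_apply D a t).bilin (hasWeakDerivAt_endExp_apply D b t)
      (LieAlgebra.ad ℂ L : L →ₗ[ℂ] L →ₗ[ℂ] L)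
    have h2 := (hasWeakDerivAt_endExp (-D) t).bilin h1 LinearMap.id
    have hb (x y : L) : (LieAlgebra.ad ℂ L : L →ₗ[ℂ] L →ₗ[ℂ] L) x y = ⁅x, y⁆ := rfl
    simp only [hb, ← hD, hcomm, LinearMap.id_apply, LinearMap.comp_apply, LinearMap.neg_apply,
      neg_add_cancel] at h2
    exact h2
  have h10 := HasWeakDerivAt.eq_of_forall_zero h 1 0
  simp only [one_smul, zero_smul, endExp_zero, LinearMap.id_apply] at h10
  rw [← h10, ← LinearMap.comp_apply, endExp_comp_neg, LinearMap.id_apply]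

end Exp

/-! ### Tangent spaces to the orbits of the adjoint group -/

section Orbit

variable {L : Type*} [LieRing L] [LieAlgebra ℂ L] [FiniteDimensional ℂ L]

lemma map_lie_of_mem_adjointGroup {g : L ≃ₗ[ℂ] L} (hg : g ∈ adjointGroup L) (a b : L) :
    g ⁅a, b⁆ = ⁅g a, g b⁆ := by
  induction hg using Subgroup.closure_induction generalizing a b with
  | mem g hg =>
    obtain ⟨y, hy⟩ := hg
    have h (z : L) : g z = endExp (LieAlgebra.ad ℂ L y) z := LinearMap.congr_fun hy z
    simp only [h]
    exact endExp_lie (fun a b => by simp) a b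
  | one => rfl
  | mul g h _ _ hg hh => simp only [LinearEquiv.mul_apply, hh, hg]
  | inv g _ hg =>
    apply g.injective
    rw [hg]
    simp only [← LinearEquiv.mul_apply, mul_inv_cancel, LinearEquiv.coe_one, id_eq]

lemma expEquiv_ad_mem_adjointGroup (y : L) : expEquiv (LieAlgebra.ad ℂ L y) ∈ adjointGroup L :=
  Subgroup.subset_closure ⟨y, rfl⟩

lemma lie_mem_orbitTangent {H : Subgroup (L ≃ₗ[ℂ] L)} {y : L}
    (hy : ∀ t : ℂ, expEquiv (LieAlgebra.ad ℂ L (t • y)) ∈ H) (p : L) :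
    ⁅y, p⁆ ∈ orbitTangent H p := by
  have hexp (u : ℂ) (z : L) : expEquiv (LieAlgebra.ad ℂ L (u • y)) z
      = endExp (u • LieAlgebra.ad ℂ L y) z := by
    rw [← map_smul]
    rfl
  refine Submodule.subset_span ⟨fun t => expEquiv (LieAlgebra.ad ℂ L (t • y)), ?_,
    Filter.Eventually.of_forall hy, Filter.Eventually.of_forall fun t z φ => ?_, fun φ => ?_⟩
  · ext z
    rw [hexp, zero_smul, endExp_zero]
    rfl
  · simp only [hexp]
    exact (hasWeakDerivAt_endExp_apply _ z t φ).differentiableAt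
  · simp only [hexp]
    simpa [endExp_zero] using hasWeakDerivAt_endExp_apply (LieAlgebra.ad ℂ L y) p 0 φ

/-- The velocity at the identity of a holomorphic curve in the adjoint group is a derivation, hence
inner. -/
lemma exists_hasWeakDerivAt_lie [LieAlgebra.IsKilling ℂ L] {g : ℂ → (L ≃ₗ[ℂ] L)} (g0 : g 0 = 1)
    (hg : ∀ᶠ t in 𝓝 (0 : ℂ), g t ∈ adjointGroup L)
    (hd : ∀ (z : L) (φ : Dual ℂ L), DifferentiableAt ℂ (fun u => φ (g u z)) 0) :
    ∃ y : L, ∀ z, HasWeakDerivAt (fun u => g u z) ⁅y, z⁆ 0 := by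
  choose D hD using fun z => exists_hasWeakDerivAt (hd z)
  let D' : L →ₗ[ℂ] L :=
    { toFun := D
      map_add' := fun a b => (hD (a + b)).unique fun φ => by
        rw [map_add]
        exact ((hD a φ).add (hD b φ)).congr_of_eventuallyEq
          (Filter.Eventually.of_forall fun u => by simp)
      map_smul' := fun c a => (hD (c • a)).unique fun φ => by
        rw [map_smul]
        exact ((hD a φ).const_mul c).congr_of_eventuallyEq
          (Filter.Eventually.of_forall fun u => by simp) }
  have hlie (a b : L) : D ⁅a, b⁆ = ⁅a, D b⁆ - ⁅b, D a⁆ := by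
    have h := (hD a).bilin (hD b) (LieAlgebra.ad ℂ L : L →ₗ[ℂ] L →ₗ[ℂ] L)
    have h' := (hD ⁅a, b⁆).unique (h.congr_of_eventuallyEq
      (hg.mono fun t ht => by simpa using map_lie_of_mem_adjointGroup ht a b))
    rw [h', g0, ← lie_skew b (D a), sub_neg_eq_add, add_comm]
    rfl
  obtain ⟨y, hy⟩ := LieDerivation.IsKilling.exists_eq_ad (⟨D', hlie⟩ : LieDerivation ℂ L L)
  refine ⟨y, fun z => ?_⟩
  have : ⁅y, z⁆ = D z := by
    rw [← show D' z = D z from rfl, ← LieDerivation.ad_apply_apply (R := ℂ), hy]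
    rfl
  rw [this]
  exact hD z

/-- The tangent space at `p` to `G · p` is `[𝔤, p]`. -/
lemma orbitTangent_adjointGroup [LieAlgebra.IsKilling ℂ L] (p : L) :
    orbitTangent (adjointGroup L) p = LinearMap.range (LieAlgebra.ad ℂ L p) := by
  apply le_antisymm
  · refine Submodule.span_le.mpr ?_
    rintro v ⟨g, g0, hg, hd, hv⟩
    obtain ⟨y, hy⟩ := exists_hasWeakDerivAt_lie g0 hg hd.self_of_nhds
    refine ⟨-y, ?_⟩
    rw [HasWeakDerivAt.unique hv (hy p)]
    simp
  · rintro _ ⟨y, rfl⟩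
    rw [LieAlgebra.ad_apply, ← lie_skew, ← neg_lie]
    exact lie_mem_orbitTangent (fun t => expEquiv_ad_mem_adjointGroup _) p

/-- The tangent space at `p` to `G(s) · p` is `[𝔤(s), p]`. -/
lemma orbitTangent_groupCentralizer [LieAlgebra.IsKilling ℂ L] (s p : L) :
    orbitTangent (groupCentralizer s) p =
      (centralizer s).toSubmodule.map (LieAlgebra.ad ℂ L p) := by
  apply le_antisymm
  · refine Submodule.span_le.mpr ?_
    rintro v ⟨g, g0, hg, hd, hv⟩
    obtain ⟨y, hy⟩ := exists_hasWeakDerivAt_lie g0 (hg.mono fun t ht => ht.1) hd.self_of_nhds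
    have hys : ⁅y, s⁆ = 0 := (hy s).unique ((HasWeakDerivAt.const s 0).congr_of_eventuallyEq
      (hg.mono fun t ht => ht.2))
    refine ⟨-y, ?_, ?_⟩
    · change ⁅s, -y⁆ = 0
      rw [lie_neg, lie_skew, hys]
    · rw [HasWeakDerivAt.unique hv (hy p)]
      simp
  · rintro _ ⟨y, hy, rfl⟩
    have hys : ⁅y, s⁆ = 0 := by
      rw [← lie_skew, show ⁅s, y⁆ = 0 from hy, neg_zero]
    rw [LieAlgebra.ad_apply, ← lie_skew, ← neg_lie]
    refine lie_mem_orbitTangent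
      (fun t => Subgroup.mem_inf.mpr ⟨expEquiv_ad_mem_adjointGroup _, ?_⟩) p
    exact endExp_apply_of_apply_eq_zero (by simp [hys])

lemma orbit_groupCentralizer_subset {s p : L} (hp : ⁅s, p⁆ = 0) :
    orbit (groupCentralizer s) p ⊆ (centralizer s).toSubmodule := by
  rintro _ ⟨g, hg, rfl⟩
  change ⁅s, g p⁆ = 0
  have h := map_lie_of_mem_adjointGroup hg.1 s p
  have hs : g s = s := hg.2
  rw [hs, hp, map_zero] at h
  exact h.symm

end Orbit

/-! ### Dirac reduction of a Lie-Poisson structure -/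

section Reduction

variable {V : Type*} [AddCommGroup V] [Module ℂ V]

/-- Covectors have at most one extension with Hamiltonian vector tangent to a cosymplectic `W`. -/
lemma tangentExtension_eq {P : LinearMap.BilinForm ℂ (Dual ℂ V)} {W : Submodule ℂ V}
    (hP : IsCosymplectic P W) {α : Dual ℂ W} {a : Dual ℂ V} (ha : a.domRestrict W = α)
    (ha' : ∀ c ∈ W.dualAnnihilator, P a c = 0) : tangentExtension P W α = a := by
  have hex : ∃ a : Dual ℂ V, a.domRestrict W = α ∧ ∀ c ∈ W.dualAnnihilator, P a c = 0 :=
    ⟨a, ha, ha'⟩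
  obtain ⟨hb, hb'⟩ := hex.choose_spec
  rw [tangentExtension, dif_pos hex, ← sub_eq_zero]
  have hmem : hex.choose - a ∈ W.dualAnnihilator := by
    rw [Submodule.mem_dualAnnihilator]
    intro w hw
    have := LinearMap.congr_fun (hb.trans ha.symm) ⟨w, hw⟩
    exact sub_eq_zero.mpr this
  exact congrArg Subtype.val (hP.1 ⟨_, hmem⟩ fun c => by
    change P (hex.choose - a) c = 0
    rw [map_sub, LinearMap.sub_apply, hb' c c.2, ha' c c.2, sub_zero])

end Reduction

section LiePoisson

variable {V : Type*} [LieRing V] [LieAlgebra ℂ V] [FiniteDimensional ℂ V]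
  {Φ : LinearMap.BilinForm ℂ V}

lemma apply_sharp (hΦ : Φ.Nondegenerate) (α : Dual ℂ V) (v : V) : Φ (sharp Φ α) v = α v := by
  rw [sharp, dif_pos hΦ]
  exact LinearMap.BilinForm.apply_toDual_symm_apply (hB := hΦ) α v

lemma sharp_apply (hΦ : Φ.Nondegenerate) (z : V) : sharp Φ (Φ z) = z := by
  rw [sharp, dif_pos hΦ]
  exact (Φ.toDual hΦ).symm_apply_apply z

lemma liePoisson_apply (y : V) (α β : Dual ℂ V) :
    liePoisson Φ y α β = Φ y ⁅sharp Φ α, sharp Φ β⁆ := rfl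

lemma mem_dualAnnihilator_orthogonal_iff (hΦ : Φ.Nondegenerate) (hs : Φ.IsSymm)
    (n : Submodule ℂ V) (α : Dual ℂ V) :
    α ∈ (Φ.orthogonal n).dualAnnihilator ↔ sharp Φ α ∈ n := by
  conv_rhs => rw [← LinearMap.BilinForm.orthogonal_orthogonal hΦ hs.isRefl n]
  rw [Submodule.mem_dualAnnihilator, LinearMap.BilinForm.mem_orthogonal_iff]
  refine forall₂_congr fun w _ => ?_
  rw [hs.eq_iff, apply_sharp hΦ]

/-- The conormal covectors of `n^⊥` are the elements of `n`, so that Dirac reduction is possible at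
`y` exactly where `(u, v) ↦ Φ(y, [u, v])` is non-degenerate on `n`. -/
lemma isCosymplectic_orthogonal_iff (hΦ : Φ.Nondegenerate) (hs : Φ.IsSymm) (n : Submodule ℂ V)
    (y : V) : IsCosymplectic (liePoisson Φ y) (Φ.orthogonal n) ↔
      ∀ u ∈ n, (∀ v ∈ n, Φ y ⁅u, v⁆ = 0) → u = 0 := by
  have hmem {u : V} (hu : u ∈ n) : Φ u ∈ (Φ.orthogonal n).dualAnnihilator := by
    rwa [mem_dualAnnihilator_orthogonal_iff hΦ hs, sharp_apply hΦ]
  constructor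
  · intro h u hu huv
    have h0 := h.1 ⟨Φ u, hmem hu⟩ fun c => by
      rw [LinearMap.BilinForm.restrict_apply, LinearMap.domRestrict_apply, liePoisson_apply,
        sharp_apply hΦ]
      exact huv _ ((mem_dualAnnihilator_orthogonal_iff hΦ hs n _).mp c.2)
    rw [← sharp_apply hΦ u, show Φ u = 0 from congrArg Subtype.val h0, map_zero]
  · intro h
    refine LinearMap.BilinForm.Nondegenerate.ofSeparatingLeft fun a ha => ?_
    have h0 := h _ ((mem_dualAnnihilator_orthogonal_iff hΦ hs n _).mp a.2) fun v hv => by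
      have := ha ⟨Φ v, hmem hv⟩
      rwa [LinearMap.BilinForm.restrict_apply, LinearMap.domRestrict_apply, liePoisson_apply,
        sharp_apply hΦ] at this
    ext v
    rw [← apply_sharp hΦ, h0]
    simp

variable {ι κ : Type*} [Fintype κ] [DecidableEq κ]

lemma isUnit_det_bracketMatrix_iff {m : Submodule ℂ V} (X : Basis κ ℂ m) (y : V) :
    IsUnit (bracketMatrix Φ (fun i => (X i : V)) (fun i => (X i : V)) y).det ↔
      ∀ u ∈ m, (∀ v ∈ m, Φ y ⁅u, v⁆ = 0) → u = 0 := by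
  let B : LinearMap.BilinForm ℂ m := LinearMap.BilinForm.restrict
    ((LieAlgebra.ad ℂ V : V →ₗ[ℂ] V →ₗ[ℂ] V).compr₂ (Φ y)) m
  have hB (u v : m) : B u v = Φ y ⁅(u : V), (v : V)⁆ := rfl
  have hm : bracketMatrix Φ (fun i => (X i : V)) (fun i => (X i : V)) y
      = LinearMap.BilinForm.toMatrix X B := by
    ext i j
    rw [LinearMap.BilinForm.toMatrix_apply]
    rfl
  rw [hm, isUnit_iff_ne_zero, ← LinearMap.BilinForm.nondegenerate_iff_det_ne_zero]
  constructor
  · intro h u hu huv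
    exact congrArg Subtype.val (h.1 ⟨u, hu⟩ fun v => huv v v.2)
  · intro h
    refine LinearMap.BilinForm.Nondegenerate.ofSeparatingLeft fun u hu => ?_
    exact Subtype.ext (h u u.2 fun v hv => hu ⟨v, hv⟩)

/-- The Poisson matrix of a slice with direction `n^⊥`, in case the constraints in `ns ⊆ n` commute
at `y` with the coordinates and with the remaining constraints `X m`: only the latter contribute to
the Dirac bracket. The element `Z i - ∑ (B C⁻¹) i l • X l` represents the tangential extension of
the differential of the `i`-th coordinate. -/
lemma slicePoissonMatrix_eq_diracMatrix (hΦ : Φ.Nondegenerate) (hs : Φ.IsSymm)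
    {n ns : Submodule ℂ V} {Z : ι → V} {X : κ → V} (hn : n = ns ⊔ Submodule.span ℂ (Set.range X))
    {N : AffineSubspace ℂ V} (hN : N.direction = Φ.orthogonal n) {y : V}
    (hXns : ∀ m, ∀ a ∈ ns, Φ y ⁅X m, a⁆ = 0) (hZns : ∀ i, ∀ a ∈ ns, Φ y ⁅Z i, a⁆ = 0)
    (hy : IsRegularAt Φ N y) (hC : IsUnit (bracketMatrix Φ X X y).det)
    {q : ι → V →ᵃ[ℂ] ℂ} (hq : ∀ i, (q i).linear = Φ.flip (Z i)) :
    slicePoissonMatrix Φ N q y = diracMatrix Φ Z X y := by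
  set B := bracketMatrix Φ Z X y with hB
  set C := bracketMatrix Φ X X y with hC'
  have hBa (i m) : Φ y ⁅Z i, X m⁆ = B i m := rfl
  have hCa (l m) : Φ y ⁅X l, X m⁆ = C l m := rfl
  let T : ι → V := fun i => Z i - ∑ l, (B * C⁻¹) i l • X l
  have hTl (i : ι) (v : V) :
      Φ y ⁅T i, v⁆ = Φ y ⁅Z i, v⁆ - ∑ l, (B * C⁻¹) i l * Φ y ⁅X l, v⁆ := by
    simp [T, sub_lie, sum_lie, map_sum]
  have hXn (m : κ) : X m ∈ n := hn ▸
    Submodule.mem_sup_right (Submodule.subset_span (Set.mem_range_self m))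
  have hTn (i : ι) : ∀ v ∈ n, Φ y ⁅T i, v⁆ = 0 := by
    suffices n ≤ LinearMap.ker ((Φ y) ∘ₗ (LieAlgebra.ad ℂ V (T i) : V →ₗ[ℂ] V)) from
      fun v hv => this hv
    rw [hn, sup_le_iff, Submodule.span_le]
    refine ⟨fun a ha => ?_, ?_⟩
    · change Φ y ⁅T i, a⁆ = 0
      rw [hTl, hZns i a ha]
      simp [hXns _ a ha]
    · rintro _ ⟨m, rfl⟩
      change Φ y ⁅T i, X m⁆ = 0
      simp only [hTl, hBa, hCa]
      rw [← Matrix.mul_apply, Matrix.mul_assoc, Matrix.nonsing_inv_mul _ hC, Matrix.mul_one,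
        sub_self]
  have hext (i : ι) : tangentExtension (liePoisson Φ y) N.direction
      ((q i).linear.domRestrict N.direction) = Φ (T i) := by
    refine tangentExtension_eq hy ?_ fun c hc => ?_
    · ext ⟨w, hw⟩
      rw [hN, LinearMap.BilinForm.mem_orthogonal_iff] at hw
      have hw' (m : κ) : Φ (X m) w = 0 := hw _ (hXn m)
      simp [T, hq, hw', hs.eq (Z i) w]
    · rw [hN, mem_dualAnnihilator_orthogonal_iff hΦ hs] at hc
      rw [liePoisson_apply, sharp_apply hΦ]
      exact hTn i _ hc
  ext i j
  have hTT : Φ y ⁅T i, T j⁆ = Φ y ⁅T i, Z j⁆ := by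
    have h0 := hTn i (Z j - T j) (by
      simp only [T, sub_sub_cancel]
      exact n.sum_mem fun l _ => n.smul_mem _ (hXn l))
    rw [lie_sub, map_sub, sub_eq_zero] at h0
    exact h0.symm
  rw [slicePoissonMatrix, Matrix.of_apply, reducedTensor, hext, hext, liePoisson_apply,
    sharp_apply hΦ, sharp_apply hΦ, hTT, hTl, diracMatrix, Matrix.add_apply, ← hB, ← hC',
    Matrix.mul_apply (M := B * C⁻¹), sub_eq_add_neg, ← Finset.sum_neg_distrib]
  congr 1
  refine Finset.sum_congr rfl fun l _ => ?_
  rw [Matrix.transpose_apply, ← lie_skew, map_neg, hBa, mul_neg, neg_neg]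

end LiePoisson

/-! ### Affine coordinates on a slice -/

section Coordinates

variable {V : Type*} [AddCommGroup V] [Module ℂ V] [FiniteDimensional ℂ V]
  {Φ : LinearMap.BilinForm ℂ V} {g n : Submodule ℂ V} {ι : Type*}

/-- If `g` and `n` are complementary, then pairing with a basis of `g` identifies `n^⊥` with
coordinate space. -/
noncomputable def orthogonalCoordEquiv (hΦ : Φ.Nondegenerate) (hs : Φ.IsSymm) (hgn : IsCompl g n)
    (Z : Basis ι ℂ g) : Φ.orthogonal n ≃ₗ[ℂ] (ι → ℂ) :=
  LinearEquiv.ofBijective (LinearMap.pi fun i => (Φ.flip (Z i)).domRestrict (Φ.orthogonal n)) <| by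
    constructor
    · rw [← LinearMap.ker_eq_bot, LinearMap.ker_eq_bot']
      rintro ⟨v, hv⟩ h
      have hg : g ≤ LinearMap.ker (Φ v) := by
        rw [← Submodule.map_subtype_top g, ← Z.span_eq, Submodule.map_span_le]
        rintro _ ⟨i, rfl⟩
        exact congrFun h i
      have hn : n ≤ LinearMap.ker (Φ v) := fun w hw => hs.isRefl _ _ (hv w hw)
      have htop : ⊤ ≤ LinearMap.ker (Φ v) := hgn.sup_eq_top ▸ sup_le hg hn
      exact Subtype.ext (hΦ.1 v fun w => htop Submodule.mem_top)
    · intro c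
      let α : Dual ℂ V := Z.constr ℂ c ∘ₗ g.projectionOnto n hgn
      have hα (w : V) : Φ ((Φ.toDual hΦ).symm α) w = α w :=
        LinearMap.BilinForm.apply_toDual_symm_apply (hB := hΦ) α w
      refine ⟨⟨(Φ.toDual hΦ).symm α, fun w hw => ?_⟩, ?_⟩
      · apply hs.isRefl
        rw [hα]
        simp [α, Submodule.projectionOnto_apply_of_mem_right hgn hw]
      · ext i
        change Φ ((Φ.toDual hΦ).symm α) (Z i) = c i
        rw [hα]
        simp [α]

lemma bijOn_affineCoord (hΦ : Φ.Nondegenerate) (hs : Φ.IsSymm) (hgn : IsCompl g n)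
    (Z : Basis ι ℂ g) (p : V) :
    Set.BijOn (fun y i => affineCoord Φ p (Z i) y)
      (AffineSubspace.mk' p (Φ.orthogonal n) : Set V) Set.univ := by
  let E := orthogonalCoordEquiv hΦ hs hgn Z
  refine ⟨fun _ _ => Set.mem_univ _, fun y hy y' hy' h => ?_, fun c _ => ?_⟩
  · have : E ⟨y - p, hy⟩ = E ⟨y' - p, hy'⟩ := h
    exact sub_left_injective (congrArg Subtype.val (E.injective this))
  · have hmem : ((E.symm c : Φ.orthogonal n) : V) + p - p ∈ Φ.orthogonal n := by
      rw [add_sub_cancel_right]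
      exact (E.symm c).2
    refine ⟨(E.symm c : V) + p, hmem, ?_⟩
    have h : (⟨_, hmem⟩ : Φ.orthogonal n) = E.symm c := Subtype.ext (add_sub_cancel_right _ _)
    change E ⟨_, hmem⟩ = c
    rw [h, E.apply_symm_apply]

end Coordinates

section Regularity

variable {V : Type*} [LieRing V] [LieAlgebra ℂ V] [FiniteDimensional ℂ V]
  {Φ : LinearMap.BilinForm ℂ V} {g n : Submodule ℂ V} {ι : Type*}

/-- Dirac reduction is possible on a neighbourhood of `p` in `p + n^⊥` if it is possible at `p`,
since this amounts to the non-vanishing of a determinant that depends continuously on the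
coordinates. -/
lemma eventually_isRegularAt (hΦ : Φ.Nondegenerate) (hs : Φ.IsSymm) (hgn : IsCompl g n)
    (Z : Basis ι ℂ g) {p : V}
    (hp : IsRegularAt Φ (AffineSubspace.mk' p (Φ.orthogonal n)) p) :
    ∀ᶠ c in 𝓝 (0 : ι → ℂ), ∀ y ∈ AffineSubspace.mk' p (Φ.orthogonal n),
      (∀ i, affineCoord Φ p (Z i) y = c i) →
      IsRegularAt Φ (AffineSubspace.mk' p (Φ.orthogonal n)) y := by
  have : Finite ι := Module.Finite.finite_basis Z
  have := Fintype.ofFinite ι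
  let E := orthogonalCoordEquiv hΦ hs hgn Z
  let b := finBasis ℂ n
  have hreg (y : V) : IsRegularAt Φ (AffineSubspace.mk' p (Φ.orthogonal n)) y ↔
      (bracketMatrix Φ (fun i => (b i : V)) (fun i => (b i : V)) y).det ≠ 0 := by
    rw [← isUnit_iff_ne_zero, isUnit_det_bracketMatrix_iff, IsRegularAt,
      AffineSubspace.direction_mk', isCosymplectic_orthogonal_iff hΦ hs]
  have hcont : Continuous fun c : ι → ℂ =>
      (bracketMatrix Φ (fun i => (b i : V)) (fun i => (b i : V)) ((E.symm c : V) + p)).det := by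
    refine Continuous.matrix_det (continuous_matrix fun i j => ?_)
    simp only [bracketMatrix, Matrix.of_apply, map_add, LinearMap.add_apply]
    exact (LinearMap.continuous_of_finiteDimensional
      (Φ.flip ⁅(b i : V), (b j : V)⁆ ∘ₗ (Φ.orthogonal n).subtype ∘ₗ E.symm.toLinearMap)).add
      continuous_const
  have h0 := (hreg p).mp hp
  have hev := hcont.continuousAt.eventually_ne (x := (0 : ι → ℂ)) (y := 0) (by simpa using h0)
  filter_upwards [hev] with c hc y hy hyc
  rw [hreg]
  have : E.symm c = ⟨y - p, hy⟩ := by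
    rw [LinearEquiv.symm_apply_eq]
    ext i
    exact (hyc i).symm
  simpa [this] using hc

end Regularity

/-! ### Centralizers and the Killing form -/

lemma disjoint_ker_range_of_isSemisimple {V : Type*} [AddCommGroup V] [Module ℂ V]
    {f : Module.End ℂ V} (hf : f.IsSemisimple) :
    Disjoint (LinearMap.ker f) (LinearMap.range f) := by
  obtain ⟨q, hq, hc⟩ := Module.End.isSemisimple_iff.mp hf (LinearMap.ker f) fun v hv => by
    change f (f v) = 0
    rw [show f v = 0 from hv, map_zero]
  refine hc.disjoint.mono_right ?_
  rintro _ ⟨w, rfl⟩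
  obtain ⟨a, ha, b, hb, rfl⟩ := Submodule.mem_sup.mp (hc.sup_eq_top ▸ Submodule.mem_top (x := w))
  rw [map_add, show f a = 0 from ha, zero_add]
  exact hq hb

lemma isCompl_orthogonal {V : Type*} [AddCommGroup V] [Module ℂ V] [FiniteDimensional ℂ V]
    {Φ : LinearMap.BilinForm ℂ V} (hΦ : Φ.Nondegenerate) {g n : Submodule ℂ V}
    (h : IsCompl g n) : IsCompl (Φ.orthogonal g) (Φ.orthogonal n) := by
  have hdisj : Disjoint (Φ.orthogonal g) (Φ.orthogonal n) := by
    rw [Submodule.disjoint_def]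
    refine fun v hg hn => hΦ.2 v fun w => ?_
    obtain ⟨a, ha, b, hb, rfl⟩ := Submodule.mem_sup.mp (h.sup_eq_top ▸ Submodule.mem_top (x := w))
    rw [map_add, LinearMap.add_apply, hg a ha, hn b hb, add_zero]
  refine ⟨hdisj, codisjoint_iff.mpr (Submodule.eq_top_of_disjoint _ _ ?_ hdisj)⟩
  have h1 := Submodule.finrank_add_eq_of_isCompl h
  have h2 := LinearMap.BilinForm.finrank_orthogonal hΦ g
  have h3 := LinearMap.BilinForm.finrank_orthogonal hΦ n
  omega

lemma isCompl_sup_of_sup_eq {V : Type*} [AddCommGroup V] [Module ℂ V] {g h m p : Submodule ℂ V}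
    (hgp : IsCompl g p) (hdisj : Disjoint h m) (hsup : h ⊔ m = g) : IsCompl h (p ⊔ m) := by
  rw [isCompl_iff, codisjoint_iff, sup_comm p, ← sup_assoc, hsup]
  refine ⟨?_, hgp.sup_eq_top⟩
  exact hdisj.disjoint_sup_right_of_disjoint_sup_left (hsup ▸ hgp.disjoint)

section Killing

variable {L : Type*} [LieRing L] [LieAlgebra ℂ L]

lemma killingForm_lie_left (a b c : L) : killingForm ℂ L ⁅a, b⁆ c = killingForm ℂ L a ⁅b, c⁆ :=
  LieModule.traceForm_apply_lie_apply ℂ L L a b c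

lemma killingForm_isSymm : (killingForm ℂ L).IsSymm := ⟨LieModule.traceForm_comm ℂ L L⟩

lemma mem_centralizer_self {s : L} : s ∈ centralizer s := lie_self s

/-- For `y ∈ 𝔤(s)` the form `(a, b) ↦ ⟨y | [a, b]⟩` pairs `𝔤(s)` and `𝔤(s)^⊥` to zero. -/
lemma killingForm_lie_eq_zero {s y a b : L} (hy : y ∈ centralizer s) (ha : a ∈ centralizer s)
    (hb : b ∈ (killingForm ℂ L).orthogonal (centralizer s).toSubmodule) :
    killingForm ℂ L y ⁅a, b⁆ = 0 := by
  rw [← killingForm_lie_left]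
  exact hb _ ((centralizer s).lie_mem hy ha)

lemma killingForm_lie_of_mem_centralizer {s a : L} (b : L) (ha : a ∈ centralizer s) :
    killingForm ℂ L s ⁅a, b⁆ = 0 := by
  rw [← killingForm_lie_left, show ⁅s, a⁆ = 0 from ha, map_zero, LinearMap.zero_apply]

variable [FiniteDimensional ℂ L]

/-- Since `ad p` is skew for the Killing form, its image is the orthogonal of its kernel. -/
lemma range_ad_eq_orthogonal [LieAlgebra.IsKilling ℂ L] (p : L) :
    LinearMap.range (LieAlgebra.ad ℂ L p) =
      (killingForm ℂ L).orthogonal (centralizer p).toSubmodule := by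
  have hΦ := LieAlgebra.IsKilling.killingForm_nondegenerate ℂ L
  have h : (centralizer p).toSubmodule =
      (killingForm ℂ L).orthogonal (LinearMap.range (LieAlgebra.ad ℂ L p)) := by
    ext z
    rw [LinearMap.BilinForm.mem_orthogonal_iff]
    constructor
    · rintro hz _ ⟨y, rfl⟩
      rw [LieAlgebra.ad_apply, ← lie_skew, map_neg, LinearMap.neg_apply, killingForm_lie_left,
        show ⁅p, z⁆ = 0 from hz, map_zero, neg_zero]
    · intro hz
      refine hΦ.2 _ fun y => ?_
      have := hz _ ⟨y, rfl⟩
      rwa [LieAlgebra.ad_apply, ← lie_skew, map_neg, LinearMap.neg_apply, killingForm_lie_left,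
        neg_eq_zero] at this
  rw [h, LinearMap.BilinForm.orthogonal_orthogonal hΦ killingForm_isSymm.isRefl]

lemma isCompl_centralizer_orthogonal [LieAlgebra.IsKilling ℂ L] {s : L}
    (hs : (LieAlgebra.ad ℂ L s).IsSemisimple) :
    IsCompl (centralizer s).toSubmodule
      ((killingForm ℂ L).orthogonal (centralizer s).toSubmodule) := by
  rw [LinearMap.BilinForm.isCompl_orthogonal_iff_disjoint killingForm_isSymm.isRefl,
    ← range_ad_eq_orthogonal]
  exact disjoint_ker_range_of_isSemisimple hs

/-- As `𝔤 = 𝔤(s) ⊕ [s, 𝔤]` is stable under `ad x`, the elements of `[x, 𝔤]` that lie in `𝔤(s)` are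
those of `[x, 𝔤(s)] = [e, 𝔤(s)]`. -/
lemma map_ad_centralizer [LieAlgebra.IsKilling ℂ L] {s e : L} (hse : ⁅s, e⁆ = 0)
    (hs : (LieAlgebra.ad ℂ L s).IsSemisimple) :
    (centralizer s).toSubmodule.map (LieAlgebra.ad ℂ L e) =
      LinearMap.range (LieAlgebra.ad ℂ L (s + e)) ⊓ (centralizer s).toSubmodule := by
  have hc := isCompl_centralizer_orthogonal hs
  have hadd {w : L} (hw : w ∈ centralizer s) : ⁅s + e, w⁆ = ⁅e, w⁆ := by
    rw [add_lie, show ⁅s, w⁆ = 0 from hw, zero_add]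
  have hmem : s + e ∈ centralizer s := (centralizer s).add_mem mem_centralizer_self hse
  apply le_antisymm
  · rintro _ ⟨w, hw, rfl⟩
    exact ⟨⟨w, hadd hw⟩, (centralizer s).lie_mem hse hw⟩
  · rintro _ ⟨⟨w, rfl⟩, hz⟩
    obtain ⟨a, ha, b, hb, rfl⟩ := Submodule.mem_sup.mp (hc.sup_eq_top ▸ Submodule.mem_top (x := w))
    refine ⟨a, ha, ?_⟩
    have hab : ⁅s + e, a + b⁆ = ⁅s + e, a⁆ + ⁅s + e, b⁆ := lie_add _ _ _
    have h1 : ⁅s + e, b⁆ ∈ centralizer s := by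
      rw [← add_sub_cancel_left ⁅s + e, a⁆ ⁅s + e, b⁆, ← hab]
      exact (centralizer s).sub_mem hz ((centralizer s).lie_mem hmem ha)
    have h2 : ⁅s + e, b⁆ ∈ (killingForm ℂ L).orthogonal (centralizer s).toSubmodule := by
      intro y hy
      change killingForm ℂ L y ⁅s + e, b⁆ = 0
      exact killingForm_lie_eq_zero hy hmem hb
    rw [LieAlgebra.ad_apply, LieAlgebra.ad_apply, hab, Submodule.disjoint_def.mp hc.disjoint _ h1 h2,
      add_zero, hadd ha]

/-- The form `(a, b) ↦ ⟨x | [a, b]⟩` has kernel `𝔤(x)`, so it is non-degenerate on a complement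
of `𝔤(x)`. -/
lemma isCosymplectic_orthogonal_of_isCompl [LieAlgebra.IsKilling ℂ L] {x : L} {n : Submodule ℂ L}
    (hn : IsCompl (centralizer x).toSubmodule n) :
    IsCosymplectic (liePoisson (killingForm ℂ L) x) ((killingForm ℂ L).orthogonal n) := by
  have hΦ := LieAlgebra.IsKilling.killingForm_nondegenerate ℂ L
  rw [isCosymplectic_orthogonal_iff hΦ killingForm_isSymm]
  intro u hu huv
  refine Submodule.disjoint_def.mp hn.disjoint u (hΦ.1 _ fun v => ?_) hu
  obtain ⟨a, ha, b, hb, rfl⟩ := Submodule.mem_sup.mp (hn.sup_eq_top ▸ Submodule.mem_top (x := v))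
  rw [map_add, killingForm_lie_left, killingForm_lie_left, huv b hb, add_zero, ← lie_skew, map_neg,
    killingForm_lie_of_mem_centralizer u ha, neg_zero]

lemma isTransverseSlice_adjointGroup [LieAlgebra.IsKilling ℂ L] {x : L} {n : Submodule ℂ L}
    (hn : IsCompl (centralizer x).toSubmodule n) :
    IsTransverseSlice (adjointGroup L) ⊤ x
      (AffineSubspace.mk' x ((killingForm ℂ L).orthogonal n)) := by
  have hΦ := LieAlgebra.IsKilling.killingForm_nondegenerate ℂ L
  have hc : IsCompl ((killingForm ℂ L).orthogonal (centralizer x).toSubmodule)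
      ((killingForm ℂ L).orthogonal n) :=
    isCompl_orthogonal hΦ hn
  rw [← range_ad_eq_orthogonal, ← orbitTangent_adjointGroup] at hc
  exact ⟨fun _ _ => trivial, fun _ _ => trivial, AffineSubspace.self_mem_mk' _ _,
    by rw [AffineSubspace.direction_mk']; exact hc.disjoint,
    by rw [AffineSubspace.direction_mk']; exact hc.sup_eq_top⟩

lemma orthogonal_le_centralizer [LieAlgebra.IsKilling ℂ L] {s : L} {n : Submodule ℂ L}
    (hns : (killingForm ℂ L).orthogonal (centralizer s).toSubmodule ≤ n) :
    (killingForm ℂ L).orthogonal n ≤ (centralizer s).toSubmodule := by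
  rw [← LinearMap.BilinForm.orthogonal_orthogonal
    (LieAlgebra.IsKilling.killingForm_nondegenerate ℂ L) killingForm_isSymm.isRefl
    (centralizer s).toSubmodule]
  exact LinearMap.BilinForm.orthogonal_le hns

lemma isTransverseSlice_groupCentralizer [LieAlgebra.IsKilling ℂ L] {s e : L} {n : Submodule ℂ L}
    (hse : ⁅s, e⁆ = 0) (hs : (LieAlgebra.ad ℂ L s).IsSemisimple)
    (hn : IsCompl (centralizer (s + e)).toSubmodule n)
    (hns : (killingForm ℂ L).orthogonal (centralizer s).toSubmodule ≤ n) :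
    IsTransverseSlice (groupCentralizer s) (centralizer s).toSubmodule e
      (AffineSubspace.mk' e ((killingForm ℂ L).orthogonal n)) := by
  have hx := isTransverseSlice_adjointGroup hn
  have hle : (killingForm ℂ L).orthogonal n ≤ (centralizer s).toSubmodule :=
    orthogonal_le_centralizer hns
  have hdisj := hx.disjoint
  have hsup := hx.sup_eq
  rw [AffineSubspace.direction_mk', orbitTangent_adjointGroup] at hdisj hsup
  refine ⟨orbit_groupCentralizer_subset hse, fun y hy => ?_, AffineSubspace.self_mem_mk' _ _,
    ?_, ?_⟩
  · have := (centralizer s).add_mem (hle hy) (show e ∈ centralizer s from hse)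
    rwa [vsub_eq_sub, sub_add_cancel] at this
  · rw [AffineSubspace.direction_mk', orbitTangent_groupCentralizer, map_ad_centralizer hse hs]
    exact hdisj.mono_left inf_le_left
  · rw [AffineSubspace.direction_mk', orbitTangent_groupCentralizer, map_ad_centralizer hse hs,
      inf_comm, inf_sup_assoc_of_le _ hle, hsup, inf_top_eq]

end Killing

/-! ### The slice inside the centralizer -/

section Centralizer

variable {L : Type*} [LieRing L] [LieAlgebra ℂ L] {s e : L} {ne : Submodule ℂ L}

/-- Inside `𝔤(s)` the slice `N` has direction `nₑ^⊥`. -/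
lemma sliceIn_direction (he : e ∈ centralizer s) (hne : ne ≤ (centralizer s).toSubmodule) :
    (sliceIn (centralizer s).toSubmodule
      (AffineSubspace.mk' e ((killingForm ℂ L).orthogonal
        ((killingForm ℂ L).orthogonal (centralizer s).toSubmodule ⊔ ne)))).direction =
    LinearMap.BilinForm.orthogonal ((killingForm ℂ L).restrict (centralizer s).toSubmodule)
      (ne.comap (centralizer s).toSubmodule.subtype) := by
  rw [← AffineSubspace.direction_mk' (⟨e, he⟩ : (centralizer s).toSubmodule)
    (LinearMap.BilinForm.orthogonal ((killingForm ℂ L).restrict (centralizer s).toSubmodule) _)]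
  congr 1
  ext y
  have hy : (y : L) - e ∈ centralizer s := (centralizer s).sub_mem y.2 he
  change (∀ w ∈ (killingForm ℂ L).orthogonal (centralizer s).toSubmodule ⊔ ne,
       killingForm ℂ L w (y - e) = 0) ↔
    ∀ w : (centralizer s).toSubmodule, (w : L) ∈ ne → killingForm ℂ L w (y - e) = 0
  refine ⟨fun h w hw => h w (Submodule.mem_sup_right hw), fun h w hw => ?_⟩
  obtain ⟨a, ha, b, hb, rfl⟩ := Submodule.mem_sup.mp hw
  rw [map_add, LinearMap.add_apply, h ⟨b, hne hb⟩ hb, killingForm_isSymm.isRefl _ _ (ha _ hy),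
    add_zero]

/-- `s` does not contribute to the brackets of elements of `𝔤(s)`. -/
lemma bracketMatrix_add {ι κ : Type*} {U : ι → L} (T : κ → L) (hU : ∀ i, U i ∈ centralizer s)
    (y : L) : bracketMatrix (killingForm ℂ L) U T (s + y)
      = bracketMatrix (killingForm ℂ L) U T y := by
  ext i j
  simp only [bracketMatrix, Matrix.of_apply, map_add, LinearMap.add_apply]
  rw [killingForm_lie_of_mem_centralizer _ (hU i), zero_add]

variable [FiniteDimensional ℂ L]

/-- At a point of `𝔤(s)` where Dirac reduction with respect to `𝔤(s)^⊥ ⊕ nₑ` is possible, so it is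
with respect to `nₑ`, because the two summands are orthogonal for the form
`(a, b) ↦ ⟨y | [a, b]⟩`. -/
lemma isUnit_det_of_isCosymplectic [LieAlgebra.IsKilling ℂ L] {κ : Type*} [Fintype κ]
    [DecidableEq κ] (X : Basis κ ℂ ne) (hne : ne ≤ (centralizer s).toSubmodule) {y : L}
    (hy : y ∈ centralizer s) (hreg : IsCosymplectic (liePoisson (killingForm ℂ L) y)
      ((killingForm ℂ L).orthogonal
        ((killingForm ℂ L).orthogonal (centralizer s).toSubmodule ⊔ ne))) :
    IsUnit (bracketMatrix (killingForm ℂ L) (fun m => (X m : L)) (fun m => (X m : L)) y).det := by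
  rw [isCosymplectic_orthogonal_iff (LieAlgebra.IsKilling.killingForm_nondegenerate ℂ L)
    killingForm_isSymm] at hreg
  rw [isUnit_det_bracketMatrix_iff]
  intro u hu huv
  refine hreg u (Submodule.mem_sup_right hu) fun v hv => ?_
  obtain ⟨a, ha, b, hb, rfl⟩ := Submodule.mem_sup.mp hv
  rw [lie_add, map_add, huv b hb, killingForm_lie_eq_zero hy (hne hu) ha, add_zero]

/-- For the Lie-Poisson structure of `𝔤(s)`, Dirac reduction is possible exactly where `Cₑ` is
invertible. -/
lemma isCosymplectic_centralizer_iff {κ : Type*} [Fintype κ] [DecidableEq κ] (X : Basis κ ℂ ne)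
    (hne : ne ≤ (centralizer s).toSubmodule)
    (hΦs : LinearMap.BilinForm.Nondegenerate
      ((killingForm ℂ L).restrict (centralizer s).toSubmodule)) (y : centralizer s) :
    IsCosymplectic (V := centralizer s)
      (liePoisson ((killingForm ℂ L).restrict (centralizer s).toSubmodule) y)
      (LinearMap.BilinForm.orthogonal ((killingForm ℂ L).restrict (centralizer s).toSubmodule)
        (ne.comap (centralizer s).toSubmodule.subtype)) ↔
    IsUnit (bracketMatrix (killingForm ℂ L) (fun m => (X m : L)) (fun m => (X m : L)) y).det := by
  rw [isUnit_det_bracketMatrix_iff, isCosymplectic_orthogonal_iff (V := centralizer s) hΦs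
    ⟨fun a b => killingForm_isSymm.eq (a : L) b⟩]
  constructor
  · intro h u hu huv
    exact congrArg Subtype.val (h ⟨u, hne hu⟩ hu fun v hv => huv v hv)
  · intro h u hu huv
    exact Subtype.ext (h u hu fun v hv => huv ⟨v, hne hv⟩ hv)

end Centralizer

end TransversePoisson
theorem mainTheorem4
    {L : Type*} [LieRing L] [LieAlgebra ℂ L] [FiniteDimensional ℂ L]
    [LieAlgebra.IsSemisimple ℂ L]
    -- the Jordan-Chevalley decomposition `x = s + e`
    (x s e : L) (hx : x = s + e) (hse : ⁅s, e⁆ = 0)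
    (hs : (LieAlgebra.ad ℂ L s).IsSemisimple) (he : IsNilpotent (LieAlgebra.ad ℂ L e))
    -- `ns = 𝔤(s)^⊥`, `ne` is a complement of `𝔤(x)` in `𝔤(s)`, and `n = ns + ne`
    (ns ne n : Submodule ℂ L)
    (hns : ns = (killingForm ℂ L).orthogonal (TransversePoisson.centralizer s).toSubmodule)
    (hne_disj : Disjoint (TransversePoisson.centralizer x).toSubmodule ne)
    (hne_sup : (TransversePoisson.centralizer x).toSubmodule ⊔ ne =
      (TransversePoisson.centralizer s).toSubmodule)
    (hn : n = ns ⊔ ne)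
    -- the slices `Nx = x + n^⊥` and `N = e + n^⊥`
    (Nx N : AffineSubspace ℂ L)
    (hNx : Nx = AffineSubspace.mk' x ((killingForm ℂ L).orthogonal n))
    (hN : N = AffineSubspace.mk' e ((killingForm ℂ L).orthogonal n))
    -- bases of `𝔤(x)` and of `ne`
    {ι κ : Type*} [Fintype κ] [DecidableEq κ]
    (Z : Module.Basis ι ℂ (TransversePoisson.centralizer x)) (X : Module.Basis κ ℂ ne) :
    -- the affine coordinates `⟨y - x | Z i⟩` (for `Nx`) and `⟨y - e | Z i⟩` (for `N`)
    let qx : ι → L →ᵃ[ℂ] ℂ :=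
      fun i => TransversePoisson.affineCoord (killingForm ℂ L) x (Z i : L)
    let q : ι → L →ᵃ[ℂ] ℂ :=
      fun i => TransversePoisson.affineCoord (killingForm ℂ L) e (Z i : L)
    -- the restrictions of the Killing form, of `N` and of the coordinates to `𝔤(s)`
    let gs : LieSubalgebra ℂ L := TransversePoisson.centralizer s
    let Φs : LinearMap.BilinForm ℂ gs := (killingForm ℂ L).restrict gs.toSubmodule
    let Ns : AffineSubspace ℂ gs := TransversePoisson.sliceIn gs.toSubmodule N
    let qs : ι → gs →ᵃ[ℂ] ℂ := fun i => (q i).comp gs.toSubmodule.subtype.toAffineMap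
    -- the common matrix `A + B_e C_e⁻¹ B_eᵀ`
    let Λ : L → Matrix ι ι ℂ := TransversePoisson.diracMatrix (killingForm ℂ L)
      (fun i => (Z i : L)) (fun m => (X m : L))
    let Ce : L → Matrix κ κ ℂ := TransversePoisson.bracketMatrix (killingForm ℂ L)
      (fun m => (X m : L)) (fun m => (X m : L))
    -- the sum `n = ns ⊕ ne` is direct and `𝔤(s)` is identified with its dual by the Killing form
    Disjoint ns ne ∧ Φs.Nondegenerate ∧
    -- `Nx` and `N` are transverse slices
    TransversePoisson.IsTransverseSlice (TransversePoisson.adjointGroup L) ⊤ x Nx ∧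
    TransversePoisson.IsTransverseSlice (TransversePoisson.groupCentralizer s)
      gs.toSubmodule e N ∧
    -- the `qx i`, resp. the `q i`, form a system of coordinates on `Nx`, resp. on `N`
    Set.BijOn (fun y i => qx i y) (Nx : Set L) Set.univ ∧
    Set.BijOn (fun y i => q i y) (N : Set L) Set.univ ∧
    -- the transverse Poisson structures are defined near `x` in `Nx`, resp. near `e` in `N`
    (∀ᶠ c in 𝓝 (0 : ι → ℂ), ∀ y ∈ Nx, (∀ i, qx i y = c i) →
      TransversePoisson.IsRegularAt (killingForm ℂ L) Nx y) ∧
    (∀ᶠ c in 𝓝 (0 : ι → ℂ), ∀ y : gs, y ∈ Ns → (∀ i, qs i y = c i) →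
      TransversePoisson.IsRegularAt Φs Ns y) ∧
    -- where they are defined, their Poisson matrices are given by `Λ`
    (∀ y ∈ Nx, TransversePoisson.IsRegularAt (killingForm ℂ L) Nx y →
      IsUnit (Ce y).det ∧
      TransversePoisson.slicePoissonMatrix (killingForm ℂ L) Nx qx y = Λ y) ∧
    (∀ y : gs, y ∈ Ns → TransversePoisson.IsRegularAt Φs Ns y →
      IsUnit (Ce (y : L)).det ∧
      TransversePoisson.slicePoissonMatrix Φs Ns qs y = Λ (y : L)) ∧
    -- points with the same coordinates have the same Poisson matrix
    (∀ y ∈ Nx, ∀ y' : gs, y' ∈ Ns → (∀ i, qx i y = qs i y') →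
      Λ y = Λ (y' : L) ∧
      (TransversePoisson.IsRegularAt (killingForm ℂ L) Nx y →
        TransversePoisson.IsRegularAt Φs Ns y' ∧
        TransversePoisson.slicePoissonMatrix (killingForm ℂ L) Nx qx y =
          TransversePoisson.slicePoissonMatrix Φs Ns qs y')) := by
  intro qx q gs Φs Ns qs Λ Ce
  have hΦ := LieAlgebra.IsKilling.killingForm_nondegenerate ℂ L
  have hsymm : (killingForm ℂ L).IsSymm := TransversePoisson.killingForm_isSymm
  subst hx hNx hN hns hn
  set Φ := killingForm ℂ L with hΦdef
  set ns := Φ.orthogonal gs.toSubmodule with hns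
  have heg : e ∈ gs := hse
  have hsg : s ∈ gs := TransversePoisson.mem_centralizer_self
  have hZg (i : ι) : (Z i : L) ∈ gs := hne_sup.le (Submodule.mem_sup_left (Z i).2)
  have hneg : ne ≤ gs.toSubmodule := hne_sup ▸ le_sup_right
  have hXg (m : κ) : (X m : L) ∈ gs := hneg (X m).2
  have hgns : IsCompl gs.toSubmodule ns := TransversePoisson.isCompl_centralizer_orthogonal hs
  have hxn := TransversePoisson.isCompl_sup_of_sup_eq hgns hne_disj hne_sup
  have hΦs : Φs.Nondegenerate :=
    (LinearMap.BilinForm.restrict_nondegenerate_iff_isCompl_orthogonal hsymm.isRefl).mpr hgns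
  have hΦssymm : Φs.IsSymm := ⟨fun a b => hsymm.eq a b⟩
  have hslx := TransversePoisson.isTransverseSlice_adjointGroup hxn
  have hsl := TransversePoisson.isTransverseSlice_groupCentralizer hse hs hxn le_sup_left
  have hNxg : ∀ y ∈ AffineSubspace.mk' (s + e) (Φ.orthogonal (ns ⊔ ne)), y ∈ gs := by
    intro y hy
    have := gs.add_mem (TransversePoisson.orthogonal_le_centralizer le_sup_left hy)
      (gs.add_mem hsg heg)
    rwa [vsub_eq_sub, sub_add_cancel] at this
  have hspan : ne = Submodule.span ℂ (Set.range fun m => (X m : L)) := by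
    have h := congrArg (Submodule.map ne.subtype) X.span_eq
    rw [Submodule.map_subtype_top, Submodule.map_span, ← Set.range_comp] at h
    exact h.symm
  have hregx : ∀ y ∈ AffineSubspace.mk' (s + e) (Φ.orthogonal (ns ⊔ ne)),
      TransversePoisson.IsRegularAt Φ (AffineSubspace.mk' (s + e) (Φ.orthogonal (ns ⊔ ne))) y →
      IsUnit (Ce y).det ∧ TransversePoisson.slicePoissonMatrix Φ
        (AffineSubspace.mk' (s + e) (Φ.orthogonal (ns ⊔ ne))) qx y = Λ y := by
    intro y hy hreg
    have hreg' := hreg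
    rw [TransversePoisson.IsRegularAt, AffineSubspace.direction_mk'] at hreg'
    have hC := TransversePoisson.isUnit_det_of_isCosymplectic X hneg (hNxg y hy) hreg'
    exact ⟨hC, TransversePoisson.slicePoissonMatrix_eq_diracMatrix hΦ hsymm (ns := ns)
      (congrArg (ns ⊔ ·) hspan) (AffineSubspace.direction_mk' _ _)
      (fun m a ha => TransversePoisson.killingForm_lie_eq_zero (hNxg y hy) (hXg m) ha)
      (fun i a ha => TransversePoisson.killingForm_lie_eq_zero (hNxg y hy) (hZg i) ha)
      hreg hC (fun i => rfl)⟩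
  have hdir : Ns.direction = Φs.orthogonal (ne.comap gs.toSubmodule.subtype) :=
    TransversePoisson.sliceIn_direction heg hneg
  have hreg (y : gs) : TransversePoisson.IsRegularAt Φs Ns y ↔ IsUnit (Ce (y : L)).det := by
    rw [TransversePoisson.IsRegularAt, hdir]
    exact TransversePoisson.isCosymplectic_centralizer_iff X hneg hΦs y
  have hmat (y : gs) (hy : TransversePoisson.IsRegularAt Φs Ns y) :
      TransversePoisson.slicePoissonMatrix Φs Ns qs y = Λ (y : L) := by
    refine TransversePoisson.slicePoissonMatrix_eq_diracMatrix (V := gs) (ns := ⊥)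
      (Z := fun i => ⟨Z i, hZg i⟩) (X := fun m => ⟨X m, hXg m⟩) hΦs hΦssymm ?_ hdir
      (by simp) (by simp) hy ((hreg y).mp hy) (fun i => rfl)
    rw [bot_sup_eq]
    apply Submodule.map_injective_of_injective gs.toSubmodule.subtype_injective
    rw [Submodule.map_comap_subtype, inf_eq_right.mpr hneg, Submodule.map_span, ← Set.range_comp]
    exact hspan
  have hbijx := TransversePoisson.bijOn_affineCoord hΦ hsymm hxn Z (s + e)
  have hbij := TransversePoisson.bijOn_affineCoord hΦ hsymm hxn Z e
  have hevx := TransversePoisson.eventually_isRegularAt hΦ hsymm hxn Z (p := s + e) (by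
    rw [TransversePoisson.IsRegularAt, AffineSubspace.direction_mk']
    exact TransversePoisson.isCosymplectic_orthogonal_of_isCompl hxn)
  -- translation by `s` maps `N` to `Nx` and matches the coordinates
  have hmem (y : gs) (hy : y ∈ Ns) :
      s + (y : L) ∈ AffineSubspace.mk' (s + e) (Φ.orthogonal (ns ⊔ ne)) := by
    have hy' : (y : L) - e ∈ Φ.orthogonal (ns ⊔ ne) := hy
    rwa [← add_sub_add_left_eq_sub _ _ s] at hy'
  have hcoord (y : gs) (i : ι) : qx i (s + (y : L)) = qs i y := by
    change Φ (s + (y : L) - (s + e)) (Z i) = Φ ((y : L) - e) (Z i)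
    rw [add_sub_add_left_eq_sub]
  have hCe (y : L) : Ce (s + y) = Ce y := TransversePoisson.bracketMatrix_add _ hXg y
  have hΛ (y : L) : Λ (s + y) = Λ y := by
    simp only [Λ, TransversePoisson.diracMatrix]
    rw [TransversePoisson.bracketMatrix_add _ hXg, TransversePoisson.bracketMatrix_add _ hZg,
      TransversePoisson.bracketMatrix_add _ hZg]
  refine ⟨hgns.disjoint.symm.mono_right hneg, hΦs, hslx, hsl, hbijx, hbij, hevx, ?_, hregx,
    fun y _ hy => ⟨(hreg y).mp hy, hmat y hy⟩, fun y hy y' hy' hyy => ?_⟩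
  · -- regularity of `Nx` at `s + y` makes `Ce` invertible there, hence at `y`
    filter_upwards [hevx] with c hc y hy hyc
    rw [hreg, ← hCe]
    exact (hregx _ (hmem y hy) (hc _ (hmem y hy) fun i => (hcoord y i).trans (hyc i))).1
  · obtain rfl : y = s + (y' : L) :=
      hbijx.injOn hy (hmem y' hy') (funext fun i => (hyy i).trans (hcoord y' i).symm)
    refine ⟨hΛ y', fun hr => ?_⟩
    obtain ⟨hC, hP⟩ := hregx _ hy hr
    have hr' := (hreg y').mpr (hCe (y' : L) ▸ hC)
    exact ⟨hr', by rw [hP, hmat y' hr', hΛ]⟩
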